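/- Let $r\ge 2$, $\mathcal A=\{1,\dots,r\}$, $\Omega=\mathcal A^{\mathbb N}$ with $\mathbb N=\{1,2,\dots\}$, with the metric $d(x,y)=2^{-\min\{n\,:\,x_n\neq y_n\}}$ for $x\ne y$ (and $d(x,x)=0$), and let $\phi_j(x)=jx=(j,x_1,x_2,\dots)$ for $j\in\mathcal A$. Let $\beta>0$, $\mu<0$, and let $A_N:\Omega\to\mathbb R$ $(N\in\mathbb N_0=\{0,1,2,\dots\})$ be functions such that * (H1) there is $M>0$ with $|A_N(x)-A_N(y)|\le M\,d(x,y)$ for all $N\in\mathbb N_0$, $x,y\in\Omega$; * (H2) $\limsup_{N\to\infty} A_N(x)/N>\mu$ for all $x\in\Omega$; * (admissibility) $\sum_{N\in\mathbb N_0} e^{\beta\mu N}\sum_{a\in\mathcal A}e^{-\beta A_N(ax)}<\infty$ for all $x\in\Omega$. (H2 and admissibility both hold, in particular, if $\liminf_{N\to\infty}A_N(x)/N>\mu$ for all $x$.) Let $\psi(y)=\sum_{N\in\mathbb N_0}e^{-\beta[A_N(y)-\mu N]}$ be the grand-canonical potential, let $q_j=\psi\circ\phi_j$ and $Q=(q_j)_{j\in\mathcal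 A}$, and let $$\mathcal L_{\beta,\mu}(f)(x)=\sum_{N\in\mathbb N_0}e^{\beta\mu N}\sum_{a\in\mathcal A}e^{-\beta A_N(ax)}f(ax)$$ be the grand-canonical Ruelle operator on $C(\Omega)$. A Borel probability $\hat\nu$ on $\Omega\times\mathcal A^{\mathbb N_0}$ with first marginal $\nu$ is *holonomic* if $\int g(\phi_{w_1}(x))\,d\hat\nu(x,w)=\int g\,d\nu$ for every continuous $g:\Omega\to\mathbb R$; let $\mathcal H$ be the set of holonomic probabilities. Write $C^+(\Omega)$ for the positive continuous functions on $\Omega$. For $\hat\nu\in\mathcal H$ the *variational entropy* is $$h_v(\hat\nu)=\inf_{g\in C^+(\Omega)}\int_\Omega\log\frac{\sum_{j\in\mathcal A}g(\phi_j(x))}{g(x)}\,d\nu(x),$$ and the *grand-canonical topological pressure* is $$P(Q)=\sup_{\hat\nu\in\mathcal H}\ \inf_{g\in C^+(\Omega)}\int_\Omega\log\frac{\mathcal L_{\beta,\mu}(g)}{g}\,d\nu .$$ Then $\mathcal L_{\beta,\mu}(g)(x)=\sum_{j\in\mathcal A}q_j(x)\,g(\phi_j(x))$ for all $g\in C(\Omega)$,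 $x\in\Omega$, and: (a) $\displaystyle P(Q)=P(\psi):=\sup_{\hat\nu\in\mathcal H}\Big\{h_v(\hat\nu)+\int_\Omega\log\psi\,d\nu\Big\}.$ (b) The set of equilibrium states, that is, of the $\hat\nu\in\mathcal H$ with $P(\psi)=h_v(\hat\nu)+\int_\Omega\log\psi\,d\nu$, is not empty. (c) $P(Q)=\log\lambda$, where $\lambda>0$ is the grand-canonical eigenvalue: $\lambda$ is the spectral radius of $\mathcal L_{\beta,\mu}$ acting on $C(\Omega)$, and there are a continuous function $h>0$ on $\Omega$ and a Borel probability $\nu$ on $\Omega$ with $\mathcal L_{\beta,\mu}h=\lambda h$, $\mathcal L_{\beta,\mu}^*\nu=\lambda\nu$ and $\int h\,d\nu=1$. -/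

import Mathlib

open MeasureTheory Filter Topology

noncomputable section

namespace GrandCanonical

/-- The symbolic space `𝒜^ℕ` over the alphabet `𝒜 = Fin r` of `r` letters, with the product topology
and the product (= Borel) σ-algebra. The coordinate `x n` is the `(n + 1)`-st letter of `x`. -/
abbrev Shift (r : ℕ) : Type := ℕ → Fin r

/-- The metric `d(x, y) = 2 ^ (-min {n ≥ 1 | x_n ≠ y_n})` for `x ≠ y`, with letters numbered from `1`
(whence the `+ 1`), and `d(x, x) = 0`. It induces the product topology. -/
def shiftDist {r : ℕ} (x y : Shift r) : ℝ :=
  open Classical in if x = y then 0 else (1 / 2 : ℝ) ^ (PiNat.firstDiff x y + 1)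

/-- The maps of the iterated function system: `φ_j (x_1, x_2, …) = (j, x_1, x_2, …)`. -/
def prepend {r : ℕ} (j : Fin r) (x : Shift r) : Shift r
  | 0 => j
  | n + 1 => x n

/-- All the functions `A N` are Lipschitz for the metric `shiftDist`, with the same constant `M`. -/
def UniformlyLipschitz {r : ℕ} (A : ℕ → Shift r → ℝ) (M : ℝ) : Prop :=
  ∀ N x y, |A N x - A N y| ≤ M * shiftDist x y

/-- The superlinearity condition `limsup_N A_N(x) / N > K` at every point; the upper limit is taken in
the extended reals. -/
def Superlinear {r : ℕ} (A : ℕ → Shift r → ℝ) (K : ℝ) : Prop :=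
  ∀ x, (K : EReal) < limsup (fun N : ℕ => ((A N x / N : ℝ) : EReal)) atTop

/-- Admissible families: `∑_N e^{β μ N} ∑_a e^{-β A_N(ax)} < ∞` at every point. -/
def Admissible {r : ℕ} (β μ : ℝ) (A : ℕ → Shift r → ℝ) : Prop :=
  ∀ x, Summable fun N : ℕ => Real.exp (β * μ * N) * ∑ a, Real.exp (-β * A N (prepend a x))

/-- The grand-canonical Ruelle operator
`L f (x) = ∑_N e^{β μ N} ∑_a e^{-β A_N(ax)} f(ax)`, for real or complex functions `f`. -/
def ruelle {r : ℕ} {E : Type*} [NormedAddCommGroup E] [NormedSpace ℝ E]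
    (β μ : ℝ) (A : ℕ → Shift r → ℝ) (f : Shift r → E) (x : Shift r) : E :=
  ∑' N : ℕ, Real.exp (β * μ * N) • ∑ a, Real.exp (-β * A N (prepend a x)) • f (prepend a x)

/-- The grand-canonical potential `ψ(y) = ∑_N e^{-β (A_N(y) - μ N)}`. -/
def potential {r : ℕ} (β μ : ℝ) (A : ℕ → Shift r → ℝ) (y : Shift r) : ℝ :=
  ∑' N : ℕ, Real.exp (-β * (A N y - μ * N))

/-- The weights `q_j(x) = ∑_N e^{-β (A_N(jx) - μ N)}`. -/
def weight {r : ℕ} (β μ : ℝ) (A : ℕ → Shift r → ℝ) (j : Fin r) (x : Shift r) : ℝ :=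
  ∑' N : ℕ, Real.exp (-β * (A N (prepend j x) - μ * N))

/-- The transfer operator `B_q g (x) = ∑_j q_j(x) g(φ_j(x))` of the system with weights `q`. -/
def transfer {r : ℕ} (q : Fin r → Shift r → ℝ) (g : Shift r → ℝ) (x : Shift r) : ℝ :=
  ∑ j, q j x * g (prepend j x)

/-- The cone `C⁺(Ω)` of positive continuous functions. -/
abbrev PosCont (r : ℕ) : Type := {g : C(Shift r, ℝ) // ∀ x, 0 < g x}

/-- The projection on the first coordinate of a probability on `𝒜^ℕ × 𝒜^{ℕ₀}`. -/
def baseMeasure {r : ℕ} (ν : ProbabilityMeasure (Shift r × (ℕ → Fin r))) : Measure (Shift r) :=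
  (ν : Measure (Shift r × (ℕ → Fin r))).map Prod.fst

/-- The holonomic probabilities on `𝒜^ℕ × 𝒜^{ℕ₀}`, whose points are pairs `(x, w)` with
`w = (w_0, w_1, …)`. -/
def holonomic (r : ℕ) : Set (ProbabilityMeasure (Shift r × (ℕ → Fin r))) :=
  {ν | ∀ g : C(Shift r, ℝ),
    ∫ p, g (prepend (p.2 1) p.1) ∂(ν : Measure (Shift r × (ℕ → Fin r))) =
      ∫ x, g x ∂(baseMeasure ν)}

/-- `inf_{g ∈ C⁺(Ω)} ∫ log (T g / g) dν`, as an extended real. -/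
def infLogRatio {r : ℕ} (T : (Shift r → ℝ) → Shift r → ℝ)
    (ν : ProbabilityMeasure (Shift r × (ℕ → Fin r))) : EReal :=
  ⨅ g : PosCont r, ((∫ x, Real.log (T g.1 x / g.1 x) ∂(baseMeasure ν) : ℝ) : EReal)

/-- The variational entropy `inf_{g ∈ C⁺(Ω)} ∫ log (B_1 g / g) dν`, with `B_1 g = ∑_j g ∘ φ_j`. -/
def entropy {r : ℕ} (ν : ProbabilityMeasure (Shift r × (ℕ → Fin r))) : EReal :=
  infLogRatio (transfer fun _ _ => 1) ν

/-- The grand-canonical topological pressure `P(Q)`: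
the supremum over the holonomic probabilities of `inf_{g ∈ C⁺(Ω)} ∫ log (L g / g) dν`. -/
def pressure {r : ℕ} (β μ : ℝ) (A : ℕ → Shift r → ℝ) : EReal :=
  ⨆ ν ∈ holonomic r, infLogRatio (ruelle β μ A) ν

/-- `P(ψ)`, the supremum over the holonomic probabilities of `h_v(ν) + ∫ log ψ dν`. -/
def potentialPressure {r : ℕ} (ψ : Shift r → ℝ) : EReal :=
  ⨆ ν ∈ holonomic r, entropy ν + ((∫ y, Real.log (ψ y) ∂(baseMeasure ν) : ℝ) : EReal)

/-- The equilibrium states for `ψ`. -/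
def equilibriumStates {r : ℕ} (ψ : Shift r → ℝ) :
    Set (ProbabilityMeasure (Shift r × (ℕ → Fin r))) :=
  {ν | ν ∈ holonomic r ∧
    potentialPressure ψ = entropy ν + ((∫ y, Real.log (ψ y) ∂(baseMeasure ν) : ℝ) : EReal)}

/-- `lam` is the spectral radius of the grand-canonical Ruelle operator as a bounded operator on the
continuous functions. As usual for the spectrum, the scalars are complex. -/
def IsSpectralRadius {r : ℕ} (β μ : ℝ) (A : ℕ → Shift r → ℝ) (lam : ℝ) : Prop :=
  ∃ T : C(Shift r, ℂ) →L[ℂ] C(Shift r, ℂ),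
    (∀ f x, T f x = ruelle β μ A f x) ∧ spectralRadius ℂ T = ENNReal.ofReal lam

/-- `lam` is the grand-canonical eigenvalue: it is positive, it is the spectral radius of the
grand-canonical Ruelle operator `L`, and there are a continuous `h > 0` and a probability `ν`
with `L h = lam h`, `L^* ν = lam ν` and `∫ h dν = 1`. -/
def IsGrandCanonicalEigenvalue {r : ℕ} (β μ : ℝ) (A : ℕ → Shift r → ℝ) (lam : ℝ) : Prop :=
  0 < lam ∧ IsSpectralRadius β μ A lam ∧
    ∃ (h : PosCont r) (ν : ProbabilityMeasure (Shift r)),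
      (∀ x, ruelle β μ A h.1 x = lam * h.1 x) ∧
      (∀ f : C(Shift r, ℝ), ∫ x, ruelle β μ A f x ∂(ν : Measure (Shift r)) =
        lam * ∫ x, f x ∂(ν : Measure (Shift r))) ∧
      ∫ x, h.1 x ∂(ν : Measure (Shift r)) = 1

end GrandCanonical

end

noncomputable section
namespace GrandCanonical

/-! Each preimage branch contributes `ψ(jx)`, so the operator is the transfer operator of the single
potential `ψ`, and `log ψ` is Lipschitz with constant `K = β M`. Everything follows from a positive
eigenfunction `h`, with eigenvalue `λ`.

To obtain `h`, solve `u = log ∑_j ψ(j·) e^{s u(j·)}` for `s < 1`, where the right side is a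
contraction. Prepending a letter halves distances, so the solutions are `K`-Lipschitz uniformly in
`s`; after normalization at a point they converge along an ultrafilter as `s → 1`
(`exists_eigenfunction`). Comparison with `h` bounds the powers of the operator by a multiple of
`λ^n`, which gives the spectral radius.

The operator `P f = L(h f) / (λ h)` is Markov, hence has an invariant probability `m`. Since `P(f ∘
σ) = f`, `m` is shift-invariant and so is the marginal of a holonomic probability; `h⁻¹ m`,
normalized, is the eigenmeasure.

For the pressure, the test function `g = h` gives the upper bound `log λ` for every probability, and
Jensen's inequality shows that no `g` goes below `log λ` for `m`
(`log_le_integral_log_transfer_div`). The substitution `g ↦ ψ g` turns the infimum into entropy plus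
`∫ log ψ`, so the lift of `m` is an equilibrium state. -/

/-! ### Invariant probabilities of Markov operators -/

theorem exists_tendsto_of_abs_le {ι : Type*} (U : Ultrafilter ι) {a : ι → ℝ} {C : ℝ}
    (h : ∀ i, |a i| ≤ C) : ∃ l, Tendsto a U (𝓝 l) := by
  obtain ⟨l, -, hl⟩ := (isCompact_Icc (a := -C) (b := C)).ultrafilter_le_nhds' (U.map a)
    (Filter.mem_map.2 (Filter.univ_mem' fun i => abs_le.1 (h i)))
  exact ⟨l, hl⟩

theorem exists_probabilityMeasure_integral_eq {X : Type*} [TopologicalSpace X] [CompactSpace X]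
    [T2Space X] [MeasurableSpace X] [BorelSpace X] (Λ : C(X, ℝ) →ₗ[ℝ] ℝ)
    (hpos : ∀ f, 0 ≤ f → 0 ≤ Λ f) (hone : Λ 1 = 1) :
    ∃ m : ProbabilityMeasure X, ∀ f : C(X, ℝ), ∫ x, f x ∂(m : Measure X) = Λ f := by
  let toCont : CompactlySupportedContinuousMap X ℝ →ₗ[ℝ] C(X, ℝ) :=
    { toFun := fun f => f.toContinuousMap
      map_add' := fun _ _ => rfl
      map_smul' := fun _ _ => rfl }
  let Λ' := PositiveLinearMap.mk₀ (Λ.comp toCont) fun f hf => hpos _ hf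
  have key (f : C(X, ℝ)) : ∫ x, f x ∂(RealRMK.rieszMeasure Λ') = Λ f :=
    RealRMK.integral_rieszMeasure Λ' (CompactlySupportedContinuousMap.continuousMapEquiv f)
  have hreal : (RealRMK.rieszMeasure Λ').real Set.univ = 1 := by
    simpa [hone] using key 1
  refine ⟨⟨RealRMK.rieszMeasure Λ', ⟨?_⟩⟩, key⟩
  rw [Measure.real, ENNReal.toReal_eq_one_iff] at hreal
  exact hreal

/-- A Markov operator on the continuous functions of a compact space has an invariant probability. -/
theorem exists_invariant_probabilityMeasure {X : Type*} [TopologicalSpace X] [CompactSpace X]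
    [T2Space X] [MeasurableSpace X] [BorelSpace X] [Nonempty X] (P : C(X, ℝ) →ₗ[ℝ] C(X, ℝ))
    (hpos : ∀ f, 0 ≤ f → 0 ≤ P f) (hone : P 1 = 1) :
    ∃ m : ProbabilityMeasure X, ∀ f : C(X, ℝ),
      ∫ x, P f x ∂(m : Measure X) = ∫ x, f x ∂(m : Measure X) := by
  obtain ⟨x₀⟩ := ‹Nonempty X›
  let U : Ultrafilter ℕ := hyperfilter ℕ
  have hU : (U : Filter ℕ) ≤ atTop := Nat.hyperfilter_le_atTop
  have hpow_pos (k : ℕ) : ∀ f, 0 ≤ f → 0 ≤ (P ^ k) f := by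
    induction k with
    | zero => exact fun f hf => hf
    | succ k ih =>
      intro f hf
      rw [pow_succ', Module.End.mul_apply]
      exact hpos _ (ih f hf)
  have hpow_one (k : ℕ) : (P ^ k) 1 = 1 := by
    induction k with
    | zero => rfl
    | succ k ih => rw [pow_succ', Module.End.mul_apply, ih, hone]
  have hbound (k : ℕ) (f : C(X, ℝ)) : |(P ^ k) f x₀| ≤ ‖f‖ := by
    have h1 := hpow_pos k (‖f‖ • 1 - f) fun x => by
      simpa using (le_abs_self _).trans (f.norm_coe_le_norm x)
    have h2 := hpow_pos k (‖f‖ • 1 + f) fun x => by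
      simpa using neg_le_iff_add_nonneg.1 ((neg_le_abs _).trans (f.norm_coe_le_norm x))
    rw [map_sub, map_smul, hpow_one] at h1
    rw [map_add, map_smul, hpow_one] at h2
    have h1 : 0 ≤ ‖f‖ * 1 - (P ^ k) f x₀ := h1 x₀
    have h2 : 0 ≤ ‖f‖ * 1 + (P ^ k) f x₀ := h2 x₀
    exact abs_le.2 ⟨by linarith, by linarith⟩
  -- Krylov–Bogoliubov: Cesàro averages of the orbit of the point mass at `x₀`. Limits along one
  -- ultrafilter exist for all `f` at once, which makes the limit linear.
  let avg (n : ℕ) : C(X, ℝ) → ℝ := fun f => (n + 1 : ℝ)⁻¹ * ∑ k ∈ Finset.range (n + 1), (P ^ k) f x₀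
  have havg (f : C(X, ℝ)) (n : ℕ) : |avg n f| ≤ ‖f‖ := by
    have hn : (0 : ℝ) < n + 1 := by positivity
    rw [abs_mul, abs_inv, abs_of_pos hn, inv_mul_le_iff₀ hn]
    calc _ ≤ ∑ k ∈ Finset.range (n + 1), |(P ^ k) f x₀| := Finset.abs_sum_le_sum_abs _ _
      _ ≤ ∑ k ∈ Finset.range (n + 1), ‖f‖ := Finset.sum_le_sum fun k _ => hbound k f
      _ = _ := by simp
  choose Λ hΛ using fun f => exists_tendsto_of_abs_le U (havg f)
  let Λ' : C(X, ℝ) →ₗ[ℝ] ℝ :=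
    { toFun := Λ
      map_add' := fun f g => tendsto_nhds_unique (hΛ (f + g)) <| by
        refine ((hΛ f).add (hΛ g)).congr fun n => ?_
        simp [avg, Finset.sum_add_distrib, mul_add]
      map_smul' := fun c f => tendsto_nhds_unique (hΛ (c • f)) <| by
        refine ((hΛ f).const_mul c).congr fun n => ?_
        simp [avg, ← Finset.mul_sum, mul_left_comm] }
  obtain ⟨m, hm⟩ := exists_probabilityMeasure_integral_eq Λ'
    (fun f hf => ge_of_tendsto' (hΛ f) fun n =>
      mul_nonneg (by positivity) (Finset.sum_nonneg fun k _ => hpow_pos k f hf x₀))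
    (tendsto_nhds_unique (hΛ 1) <| tendsto_const_nhds.congr fun n => by
      simp only [avg, hpow_one, ContinuousMap.one_apply, Finset.sum_const, Finset.card_range,
        nsmul_eq_mul, mul_one, Nat.cast_add, Nat.cast_one]
      rw [inv_mul_cancel₀ (by positivity)])
  refine ⟨m, fun f => ?_⟩
  rw [hm, hm]
  refine sub_eq_zero.1 (tendsto_nhds_unique ((hΛ (P f)).sub (hΛ f)) ?_)
  have hlim : Tendsto (fun n : ℕ => (n + 1 : ℝ)⁻¹ * (2 * ‖f‖)) U (𝓝 0) := by
    have := (tendsto_one_div_add_atTop_nhds_zero_nat (𝕜 := ℝ)).mul_const (2 * ‖f‖)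
    simp only [one_div, zero_mul] at this
    exact this.mono_left hU
  refine squeeze_zero_norm (fun n => ?_) hlim
  have hn : (0 : ℝ) < n + 1 := by positivity
  -- The sum telescopes to two bounded terms, which the factor `1 / (n + 1)` sends to zero.
  have : avg n (P f) - avg n f = (n + 1 : ℝ)⁻¹ * ((P ^ (n + 1)) f x₀ - (P ^ 0) f x₀) := by
    rw [← Finset.sum_range_sub fun k => (P ^ k) f x₀, Finset.sum_sub_distrib, mul_sub]
    rfl
  rw [this, Real.norm_eq_abs, abs_mul, abs_inv, abs_of_pos hn]
  gcongr
  linarith [abs_sub ((P ^ (n + 1)) f x₀) ((P ^ 0) f x₀), hbound (n + 1) f, hbound 0 f]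


/-! ### Metric and shift on the symbolic space -/

section Symbolic

variable {r : ℕ}

theorem shiftDist_self (x : Shift r) : shiftDist x x = 0 := by simp [shiftDist]

theorem shiftDist_of_ne {x y : Shift r} (h : x ≠ y) :
    shiftDist x y = (1 / 2 : ℝ) ^ (PiNat.firstDiff x y + 1) := by simp [shiftDist, h]

theorem shiftDist_nonneg (x y : Shift r) : 0 ≤ shiftDist x y := by
  unfold shiftDist; split_ifs <;> positivity

theorem shiftDist_le_one (x y : Shift r) : shiftDist x y ≤ 1 := by
  unfold shiftDist
  split_ifs
  · exact zero_le_one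
  · exact pow_le_one₀ (by norm_num) (by norm_num)

theorem shiftDist_comm (x y : Shift r) : shiftDist x y = shiftDist y x := by
  rcases eq_or_ne x y with rfl | h
  · rfl
  · rw [shiftDist_of_ne h, shiftDist_of_ne h.symm, PiNat.firstDiff_comm]

/-- A common first letter delays the first disagreement by one place. This factor `1 / 2` makes the
Lipschitz constant of the discounted solutions independent of the discount. -/
theorem shiftDist_prepend_le (j : Fin r) (x y : Shift r) :
    shiftDist (prepend j x) (prepend j y) ≤ shiftDist x y / 2 := by
  by_cases h : prepend j x = prepend j y
  · rw [h, shiftDist_self]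
    exact div_nonneg (shiftDist_nonneg x y) zero_le_two
  have hxy : x ≠ y := fun e => h (by rw [e])
  have hle : PiNat.firstDiff x y + 1 ≤ PiNat.firstDiff (prepend j x) (prepend j y) := by
    rw [← PiNat.mem_cylinder_iff_le_firstDiff h, PiNat.mem_cylinder_iff]
    intro i hi
    cases i with
    | zero => rfl
    | succ i => exact PiNat.apply_eq_of_lt_firstDiff (x := x) (y := y) (Nat.lt_of_succ_lt_succ hi)
  rw [shiftDist_of_ne h, shiftDist_of_ne hxy]
  calc (1 / 2 : ℝ) ^ (PiNat.firstDiff (prepend j x) (prepend j y) + 1)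
      ≤ (1 / 2 : ℝ) ^ (PiNat.firstDiff x y + 1 + 1) :=
        pow_le_pow_of_le_one (by norm_num) (by norm_num) (by omega)
    _ = _ := by rw [pow_succ]; ring

theorem tendsto_shiftDist (x : Shift r) : Tendsto (fun y => shiftDist y x) (𝓝 x) (𝓝 0) := by
  rw [Metric.tendsto_nhds]
  intro ε hε
  obtain ⟨n, hn⟩ := exists_pow_lt_of_lt_one hε (by norm_num : (1 / 2 : ℝ) < 1)
  filter_upwards [(PiNat.isOpen_cylinder (fun _ => Fin r) x n).mem_nhds
    (PiNat.self_mem_cylinder x n)] with y hy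
  rw [Real.dist_eq, sub_zero, abs_of_nonneg (shiftDist_nonneg _ _)]
  by_cases h : y = x
  · rw [h, shiftDist_self]; exact hε
  · rw [shiftDist_of_ne h]
    refine lt_of_le_of_lt (pow_le_pow_of_le_one (by norm_num) (by norm_num) ?_) hn
    have := (PiNat.mem_cylinder_iff_le_firstDiff h n).1 hy
    omega

theorem continuous_of_abs_sub_le {u : Shift r → ℝ} {K : ℝ}
    (hu : ∀ x y, |u x - u y| ≤ K * shiftDist x y) : Continuous u := by
  refine continuous_iff_continuousAt.2 fun x => tendsto_iff_dist_tendsto_zero.2 ?_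
  refine squeeze_zero (fun _ => dist_nonneg) (fun y => (Real.dist_eq _ _).trans_le (hu y x)) ?_
  simpa using (tendsto_shiftDist x).const_mul K

theorem continuous_prepend (j : Fin r) : Continuous (prepend j) := by
  refine continuous_pi fun n => ?_
  cases n with
  | zero => exact continuous_const
  | succ n => exact continuous_apply n

/-- The left shift `σ(x_1, x_2, …) = (x_2, x_3, …)`. -/
def leftShift (x : Shift r) : Shift r := fun n => x (n + 1)

theorem continuous_leftShift : Continuous (leftShift : Shift r → Shift r) :=
  continuous_pi fun n => continuous_apply (n + 1)

theorem leftShift_prepend (j : Fin r) (x : Shift r) : leftShift (prepend j x) = x := rfl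

theorem prepend_leftShift (x : Shift r) : prepend (x 0) (leftShift x) = x := by
  funext n
  cases n <;> rfl

end Symbolic

/-! ### Regularity of the grand-canonical potential -/

section Potential

variable {r : ℕ} {β μ : ℝ} {A : ℕ → Shift r → ℝ}

/-- Since `y` is its first letter prepended to its shift, the terms are dominated by those of the
admissibility series at `leftShift y`. -/
theorem summable_potential (hA : Admissible β μ A) (y : Shift r) :
    Summable fun N : ℕ => Real.exp (-β * (A N y - μ * N)) := by
  refine Summable.of_nonneg_of_le (fun N => (Real.exp_pos _).le) (fun N => ?_) (hA (leftShift y))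
  calc Real.exp (-β * (A N y - μ * N))
      = Real.exp (β * μ * N) * Real.exp (-β * A N (prepend (y 0) (leftShift y))) := by
        rw [prepend_leftShift, ← Real.exp_add]; ring_nf
    _ ≤ _ := by
        gcongr
        exact Finset.single_le_sum (f := fun a => Real.exp (-β * A N (prepend a (leftShift y))))
          (fun a _ => (Real.exp_pos _).le) (Finset.mem_univ _)

theorem potential_pos (hA : Admissible β μ A) (y : Shift r) : 0 < potential β μ A y :=
  (summable_potential hA y).tsum_pos (fun _ => (Real.exp_pos _).le) 0 (Real.exp_pos _)

theorem potential_le_exp_mul (hβ : 0 < β) {M : ℝ} (hLip : UniformlyLipschitz A M)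
    (hA : Admissible β μ A) (x y : Shift r) :
    potential β μ A x ≤ Real.exp (β * M * shiftDist x y) * potential β μ A y := by
  unfold potential
  rw [← tsum_mul_left]
  refine (summable_potential hA x).tsum_le_tsum (fun N => ?_) ((summable_potential hA y).mul_left _)
  rw [← Real.exp_add, Real.exp_le_exp]
  have := (abs_le.1 (hLip N x y)).1
  nlinarith

/-- Stated for general `E` to serve both the real operator of the pressure and the complex one of
the spectrum. -/
theorem ruelle_eq_sum {E : Type*} [NormedAddCommGroup E] [NormedSpace ℝ E]
    (hA : Admissible β μ A) (f : Shift r → E) (x : Shift r) :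
    ruelle β μ A f x = ∑ a, potential β μ A (prepend a x) • f (prepend a x) := by
  have h (N : ℕ) : Real.exp (β * μ * N) • ∑ a, Real.exp (-β * A N (prepend a x)) • f (prepend a x)
      = ∑ a, Real.exp (-β * (A N (prepend a x) - μ * N)) • f (prepend a x) := by
    rw [Finset.smul_sum]
    refine Finset.sum_congr rfl fun a _ => ?_
    rw [smul_smul, ← Real.exp_add]
    ring_nf
  unfold ruelle potential
  simp_rw [h]
  rw [Summable.tsum_finsetSum fun a _ => (summable_potential hA _).smul_const _]
  exact Finset.sum_congr rfl fun a _ => (summable_potential hA _).tsum_smul_const _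

theorem continuous_of_le_exp_mul {ψ : Shift r → ℝ} {K : ℝ} (hpos : ∀ x, 0 < ψ x)
    (h : ∀ x y, ψ x ≤ Real.exp (K * shiftDist x y) * ψ y) : Continuous ψ := by
  have hlog : Continuous fun x => Real.log (ψ x) := by
    have key (x y) : Real.log (ψ x) - Real.log (ψ y) ≤ K * shiftDist x y := by
      have := Real.log_le_log (hpos x) (h x y)
      rw [Real.log_mul (Real.exp_ne_zero _) (hpos y).ne', Real.log_exp] at this
      linarith
    refine continuous_of_abs_sub_le fun x y => abs_sub_le_iff.2 ⟨key x y, ?_⟩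
    rw [shiftDist_comm]
    exact key y x
  exact hlog.rexp.congr fun x => Real.exp_log (hpos x)

end Potential

/-- Used for both the contraction estimate and the Lipschitz estimate of `logTransfer`. -/
theorem log_sum_sub_log_sum_le {ι : Type*} [Fintype ι] [Nonempty ι] {a b : ι → ℝ} {c : ℝ}
    (ha : ∀ i, 0 < a i) (hb : ∀ i, 0 < b i) (h : ∀ i, a i ≤ Real.exp c * b i) :
    Real.log (∑ i, a i) - Real.log (∑ i, b i) ≤ c := by
  have hA : 0 < ∑ i, a i := Finset.sum_pos (fun i _ => ha i) Finset.univ_nonempty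
  have hB : 0 < ∑ i, b i := Finset.sum_pos (fun i _ => hb i) Finset.univ_nonempty
  have : ∑ i, a i ≤ Real.exp c * ∑ i, b i := by
    rw [Finset.mul_sum]
    exact Finset.sum_le_sum fun i _ => h i
  have := Real.log_le_log hA this
  rw [Real.log_mul (Real.exp_ne_zero _) hB.ne', Real.log_exp] at this
  linarith

/-! ### Positive eigenfunction by vanishing discount -/

section Eigenfunction

variable {r : ℕ} [NeZero r]

/-- The operator `u ↦ log ∑_j ψ(j·) e^{s u(j·)}`, a contraction for `0 ≤ s < 1`. -/
def logTransfer (ψ : PosCont r) (s : ℝ) (u : C(Shift r, ℝ)) : C(Shift r, ℝ) where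
  toFun x := Real.log (∑ j, ψ.1 (prepend j x) * Real.exp (s * u (prepend j x)))
  continuous_toFun := by
    refine Continuous.log (continuous_finsetSum _ fun j _ => ?_) fun x =>
      (Finset.sum_pos (fun j _ => mul_pos (ψ.2 _) (Real.exp_pos _)) Finset.univ_nonempty).ne'
    have := continuous_prepend j
    fun_prop

theorem logTransfer_apply (ψ : PosCont r) (s : ℝ) (u : C(Shift r, ℝ)) (x : Shift r) :
    logTransfer ψ s u x = Real.log (∑ j, ψ.1 (prepend j x) * Real.exp (s * u (prepend j x))) := rfl

theorem contractingWith_logTransfer (ψ : PosCont r) {s : NNReal} (hs : s < 1) :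
    ContractingWith s (logTransfer ψ s) := by
  refine ⟨hs, LipschitzWith.of_dist_le_mul fun u v => ?_⟩
  have key (u v : C(Shift r, ℝ)) (x : Shift r) :
      logTransfer ψ s u x - logTransfer ψ s v x ≤ s * dist u v := by
    refine log_sum_sub_log_sum_le (fun j => mul_pos (ψ.2 _) (Real.exp_pos _))
      (fun j => mul_pos (ψ.2 _) (Real.exp_pos _)) fun j => ?_
    rw [mul_left_comm, ← Real.exp_add]
    gcongr
    · exact (ψ.2 _).le
    have h1 := (le_abs_self _).trans
      ((Real.dist_eq _ _).symm.trans_le (ContinuousMap.dist_apply_le_dist (f := u) (g := v)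
        (prepend j x)))
    nlinarith [s.2, mul_le_mul_of_nonneg_left h1 s.2]
  refine (ContinuousMap.dist_le (by positivity)).2 fun x => ?_
  rw [Real.dist_eq]
  refine abs_sub_le_iff.2 ⟨key u v x, ?_⟩
  rw [dist_comm u v]
  exact key v u x

/-- The constant `K` reproduces itself: at the halved distance `ψ` contributes `K / 2` and `s u` at
most `K / 2`, whatever `s ≤ 1` is. -/
theorem abs_logTransfer_sub_le (ψ : PosCont r) {K : ℝ}
    (hψ : ∀ x y, ψ.1 x ≤ Real.exp (K * shiftDist x y) * ψ.1 y) (hK : 0 ≤ K) {s : ℝ} (hs0 : 0 ≤ s)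
    (hs1 : s ≤ 1) {u : C(Shift r, ℝ)} (hu : ∀ x y, |u x - u y| ≤ K * shiftDist x y) (x y : Shift r) :
    |logTransfer ψ s u x - logTransfer ψ s u y| ≤ K * shiftDist x y := by
  have key (x y : Shift r) :
      logTransfer ψ s u x - logTransfer ψ s u y ≤ K * shiftDist x y := by
    refine log_sum_sub_log_sum_le (fun j => mul_pos (ψ.2 _) (Real.exp_pos _))
      (fun j => mul_pos (ψ.2 _) (Real.exp_pos _)) fun j => ?_
    have hd : K * shiftDist (prepend j x) (prepend j y) ≤ K * shiftDist x y / 2 := by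
      rw [mul_div_assoc]
      exact mul_le_mul_of_nonneg_left (shiftDist_prepend_le j x y) hK
    have hd0 : 0 ≤ K * shiftDist x y := mul_nonneg hK (shiftDist_nonneg x y)
    have h1 : u (prepend j x) - u (prepend j y) ≤ K * shiftDist x y / 2 :=
      (le_abs_self _).trans ((hu _ _).trans hd)
    calc ψ.1 (prepend j x) * Real.exp (s * u (prepend j x))
        ≤ (Real.exp (K * shiftDist x y / 2) * ψ.1 (prepend j y)) *
          Real.exp (K * shiftDist x y / 2 + s * u (prepend j y)) := by
          gcongr
          · exact mul_nonneg (Real.exp_pos _).le (ψ.2 _).le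
          · refine (hψ _ (prepend j y)).trans ?_
            gcongr
            exact (ψ.2 _).le
          · nlinarith
      _ = _ := by
          rw [Real.exp_add, show K * shiftDist x y = K * shiftDist x y / 2 + K * shiftDist x y / 2
            by ring, Real.exp_add]
          ring_nf
  refine abs_sub_le_iff.2 ⟨key x y, ?_⟩
  rw [shiftDist_comm]
  exact key y x

theorem exists_discounted_solution (ψ : PosCont r) {K : ℝ}
    (hψ : ∀ x y, ψ.1 x ≤ Real.exp (K * shiftDist x y) * ψ.1 y) (hK : 0 ≤ K) {s : ℝ} (hs0 : 0 ≤ s)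
    (hs1 : s < 1) : ∃ u : C(Shift r, ℝ), (∀ x y, |u x - u y| ≤ K * shiftDist x y) ∧
      ∀ x, ∑ j, ψ.1 (prepend j x) * Real.exp (s * u (prepend j x)) = Real.exp (u x) := by
  lift s to NNReal using hs0
  have hc := contractingWith_logTransfer ψ (s := s) (by exact_mod_cast hs1)
  refine ⟨hc.fixedPoint, ?_, fun x => ?_⟩
  -- The iterates from `0` all satisfy the Lipschitz bound, which survives in the limit.
  · have hiter (n : ℕ) : ∀ x y, |(logTransfer ψ s)^[n] 0 x - (logTransfer ψ s)^[n] 0 y| ≤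
        K * shiftDist x y := by
      induction n with
      | zero => intro x y; simpa using mul_nonneg hK (shiftDist_nonneg x y)
      | succ n ih =>
        rw [Function.iterate_succ_apply']
        exact abs_logTransfer_sub_le ψ hψ hK s.2 hs1.le ih
    have hlim := hc.tendsto_iterate_fixedPoint 0
    have hev (x : Shift r) := ((continuous_eval_const (F := C(Shift r, ℝ)) x).tendsto _).comp hlim
    intro x y
    exact le_of_tendsto' ((hev x).sub (hev y)).abs fun n => hiter n x y
  · have := congrArg (fun f : C(Shift r, ℝ) => Real.exp (f x)) hc.fixedPoint_isFixedPt
    simp only [logTransfer_apply] at this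
    rwa [Real.exp_log (Finset.sum_pos (fun j _ => mul_pos (ψ.2 _) (Real.exp_pos _))
      Finset.univ_nonempty)] at this

/-- A transfer operator whose potential has a Lipschitz logarithm has a positive continuous
eigenfunction, obtained as a limit of solutions of the discounted equations. -/
theorem exists_eigenfunction (ψ : PosCont r) {K : ℝ}
    (hψ : ∀ x y, ψ.1 x ≤ Real.exp (K * shiftDist x y) * ψ.1 y) (hK : 0 ≤ K) :
    ∃ lam : ℝ, 0 < lam ∧ ∃ h : PosCont r,
      ∀ x, ∑ j, ψ.1 (prepend j x) * h.1 (prepend j x) = lam * h.1 x := by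
  let s : ℕ → ℝ := fun n => 1 - 1 / (n + 1 : ℝ)
  have hs (n : ℕ) : 0 ≤ s n ∧ s n < 1 := by
    have hn : (0 : ℝ) < n + 1 := by positivity
    refine ⟨sub_nonneg.2 ((div_le_one hn).2 ?_), sub_lt_self _ (by positivity)⟩
    linarith [(Nat.cast_nonneg n : (0 : ℝ) ≤ n)]
  choose u hu hfix using fun n => exists_discounted_solution ψ hψ hK (hs n).1 (hs n).2
  let x₀ : Shift r := fun _ => 0
  let U : Ultrafilter ℕ := hyperfilter ℕ
  have hsU : Tendsto s U (𝓝 1) := by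
    have := (tendsto_one_div_add_atTop_nhds_zero_nat (𝕜 := ℝ)).const_sub 1
    rw [sub_zero] at this
    exact this.mono_left Nat.hyperfilter_le_atTop
  -- The values `u n x` need not stay bounded as `s n → 1`, but the differences from the value at
  -- `x₀` are at most `K`, as distances are at most `1`.
  choose v hv using fun x => exists_tendsto_of_abs_le U (a := fun n => u n x - u n x₀) (C := K)
    fun n => (hu n x x₀).trans (mul_le_of_le_one_right hK (shiftDist_le_one _ _))
  have hvLip (x y : Shift r) : |v x - v y| ≤ K * shiftDist x y :=
    le_of_tendsto' ((hv x).sub (hv y)).abs fun n => by simpa using hu n x y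
  -- Normalizing the discounted equation at `x₀` leaves a factor that does not depend on `x`. Its
  -- limit is therefore the same at all points: it is the eigenvalue.
  have hratio (x : Shift r) : Tendsto (fun n => Real.exp ((1 - s n) * u n x₀)) U
      (𝓝 ((∑ j, ψ.1 (prepend j x) * Real.exp (1 * v (prepend j x))) / Real.exp (v x))) := by
    have hlim : Tendsto (fun n => (∑ j, ψ.1 (prepend j x) *
        Real.exp (s n * (u n (prepend j x) - u n x₀))) / Real.exp (u n x - u n x₀)) U
        (𝓝 ((∑ j, ψ.1 (prepend j x) * Real.exp (1 * v (prepend j x))) / Real.exp (v x))) :=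
      (tendsto_finsetSum _ fun j _ =>
        (hsU.mul (hv (prepend j x))).rexp.const_mul (ψ.1 (prepend j x))).div (hv x).rexp
          (Real.exp_ne_zero _)
    refine hlim.congr fun n => ?_
    have hexp (j : Fin r) : Real.exp (s n * (u n (prepend j x) - u n x₀)) =
        Real.exp (s n * u n (prepend j x)) * Real.exp (-(s n * u n x₀)) := by
      rw [← Real.exp_add]; ring_nf
    simp_rw [hexp, ← mul_assoc]
    rw [← Finset.sum_mul, hfix, ← Real.exp_add, ← Real.exp_sub]
    ring_nf
  refine ⟨(∑ j, ψ.1 (prepend j x₀) * Real.exp (1 * v (prepend j x₀))) / Real.exp (v x₀),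
    div_pos (Finset.sum_pos (fun j _ => mul_pos (ψ.2 _) (Real.exp_pos _)) Finset.univ_nonempty)
      (Real.exp_pos _),
    ⟨⟨fun x => Real.exp (v x), (continuous_of_abs_sub_le hvLip).rexp⟩, fun x => Real.exp_pos _⟩,
    fun x => ?_⟩
  rw [tendsto_nhds_unique (hratio x₀) (hratio x)]
  simp only [one_mul]
  exact (div_mul_cancel₀ _ (Real.exp_ne_zero (v x))).symm

end Eigenfunction

/-! ### Spectral radius -/

section SpectralRadius

variable {r : ℕ}

/-- The transfer operator of the potential `ψ`, on complex continuous functions. -/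
def complexTransfer (ψ : PosCont r) : C(Shift r, ℂ) →ₗ[ℂ] C(Shift r, ℂ) where
  toFun f :=
    ⟨fun x => ∑ j, ψ.1 (prepend j x) • f (prepend j x), continuous_finsetSum _ fun j _ => by
      have := continuous_prepend j
      fun_prop⟩
  map_add' f g := by ext x; simp [Finset.sum_add_distrib]
  map_smul' c f := by ext x; simp [Finset.mul_sum, mul_left_comm]

theorem complexTransfer_apply (ψ : PosCont r) (f : C(Shift r, ℂ)) (x : Shift r) :
    complexTransfer ψ f x = ∑ j, ψ.1 (prepend j x) • f (prepend j x) := rfl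

theorem norm_complexTransfer_pow_le (ψ h : PosCont r) {lam : ℝ}
    (heig : ∀ x, ∑ j, ψ.1 (prepend j x) * h.1 (prepend j x) = lam * h.1 x) {f : C(Shift r, ℂ)}
    {C : ℝ} (hf : ∀ x, ‖f x‖ ≤ C * h.1 x) (n : ℕ) (x : Shift r) :
    ‖(complexTransfer ψ ^ n) f x‖ ≤ lam ^ n * C * h.1 x := by
  induction n generalizing x with
  | zero => simpa using hf x
  | succ n ih =>
    rw [pow_succ', Module.End.mul_apply, complexTransfer_apply]
    calc ‖∑ j, ψ.1 (prepend j x) • (complexTransfer ψ ^ n) f (prepend j x)‖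
        ≤ ∑ j, ψ.1 (prepend j x) * (lam ^ n * C * h.1 (prepend j x)) := by
          refine norm_sum_le_of_le _ fun j _ => ?_
          rw [norm_smul, Real.norm_of_nonneg (ψ.2 _).le]
          exact mul_le_mul_of_nonneg_left (ih _) (ψ.2 _).le
      _ = lam ^ n * C * ∑ j, ψ.1 (prepend j x) * h.1 (prepend j x) := by
          rw [Finset.mul_sum]
          exact Finset.sum_congr rfl fun j _ => by ring
      _ = _ := by rw [heig]; ring

theorem exists_norm_complexTransfer_pow_le [NeZero r] (ψ h : PosCont r) {lam : ℝ} (hlam : 0 < lam)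
    (heig : ∀ x, ∑ j, ψ.1 (prepend j x) * h.1 (prepend j x) = lam * h.1 x) :
    ∃ D : ℝ, 0 < D ∧ ∀ n f, ‖(complexTransfer ψ ^ n) f‖ ≤ lam ^ n * D * ‖f‖ := by
  obtain ⟨z, -, hz⟩ := isCompact_univ.exists_isMinOn Set.univ_nonempty h.1.continuous.continuousOn
  have hz (x : Shift r) : h.1 z ≤ h.1 x := hz (Set.mem_univ x)
  have hle (x : Shift r) : h.1 x ≤ ‖h.1‖ := (le_abs_self _).trans (h.1.norm_coe_le_norm x)
  have hz0 : 0 < h.1 z := h.2 z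
  -- The ratio of the maximum to the minimum of `h` is the cost of passing between the sup norm and
  -- domination by `h`.
  refine ⟨‖h.1‖ / h.1 z, div_pos (hz0.trans_le (hle z)) hz0, fun n f => ?_⟩
  refine (ContinuousMap.norm_le _ (by positivity)).2 fun x => ?_
  refine (norm_complexTransfer_pow_le ψ h heig (C := ‖f‖ / h.1 z) (fun y => ?_) n x).trans ?_
  · rw [div_mul_eq_mul_div, le_div_iff₀ hz0]
    exact mul_le_mul (f.norm_coe_le_norm y) (hz y) hz0.le (norm_nonneg _)
  · calc lam ^ n * (‖f‖ / h.1 z) * h.1 x ≤ lam ^ n * (‖f‖ / h.1 z) * ‖h.1‖ := by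
          gcongr
          exact hle x
      _ = _ := by ring

theorem isSpectralRadius_of_eigenfunction [NeZero r] {β μ : ℝ} {A : ℕ → Shift r → ℝ}
    (hA : Admissible β μ A) (ψ h : PosCont r) (hψ : ∀ x, ψ.1 x = potential β μ A x) {lam : ℝ}
    (hlam : 0 < lam)
    (heig : ∀ x, ∑ j, ψ.1 (prepend j x) * h.1 (prepend j x) = lam * h.1 x) :
    IsSpectralRadius β μ A lam := by
  obtain ⟨D, hD, hbound⟩ := exists_norm_complexTransfer_pow_le ψ h hlam heig
  let T : C(Shift r, ℂ) →L[ℂ] C(Shift r, ℂ) :=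
    (complexTransfer ψ).mkContinuous (lam * D) fun f => by simpa using hbound 1 f
  have hT (n : ℕ) (f : C(Shift r, ℂ)) : (T ^ n) f = (complexTransfer ψ ^ n) f := by
    induction n with
    | zero => rfl
    | succ n ih =>
      rw [pow_succ', pow_succ', mul_apply_eq_comp, ih]
      rfl
  refine ⟨T, fun f x => ?_, le_antisymm ?_ ?_⟩
  · rw [ruelle_eq_sum hA]
    simp only [← hψ]
    rfl
  · have hnorm (n : ℕ) : ‖T ^ n‖ ≤ lam ^ n * D :=
      ContinuousLinearMap.opNorm_le_bound _ (by positivity) fun f => by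
        rw [hT]; exact hbound n f
    -- Gelfand's formula: `D` is independent of `n`, so `D ^ (1 / n) → 1`.
    have hlim : Tendsto (fun n : ℕ => ENNReal.ofReal (lam * D ^ (1 / n : ℝ))) atTop
        (𝓝 (ENNReal.ofReal lam)) := by
      refine ENNReal.tendsto_ofReal ?_
      have := ((Real.continuous_const_rpow hD.ne').tendsto 0).comp
        (tendsto_const_div_atTop_nhds_zero_nat (1 : ℝ))
      simpa using this.const_mul lam
    refine le_of_tendsto_of_tendsto
      (spectrum.pow_norm_pow_one_div_tendsto_nhds_spectralRadius T) hlim ?_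
    filter_upwards [eventually_gt_atTop 0] with n hn
    refine ENNReal.ofReal_le_ofReal ?_
    calc ‖T ^ n‖ ^ (1 / n : ℝ) ≤ (lam ^ n * D) ^ (1 / n : ℝ) :=
          Real.rpow_le_rpow (norm_nonneg _) (hnorm n) (by positivity)
      _ = _ := by
          rw [Real.mul_rpow (by positivity) hD.le, one_div,
            Real.pow_rpow_inv_natCast hlam.le hn.ne']
  -- `lam - T` annihilates the nonzero function `h`, so it has no left inverse.
  · have hmem : (lam : ℂ) ∈ spectrum ℂ T := by
      rw [spectrum.mem_iff]
      intro hunit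
      obtain ⟨S, hS⟩ := hunit.exists_left_inv
      let hc : C(Shift r, ℂ) := ⟨fun x => (h.1 x : ℂ), by fun_prop⟩
      have hker : (algebraMap ℂ (C(Shift r, ℂ) →L[ℂ] C(Shift r, ℂ)) lam - T) hc = 0 := by
        ext x
        have := congrArg (fun t : ℝ => (t : ℂ)) (heig x)
        push_cast at this
        simp [Algebra.algebraMap_eq_smul_one, T, complexTransfer_apply, hc, this]
      have hzero : hc = 0 := by
        have := congrArg (fun R : C(Shift r, ℂ) →L[ℂ] C(Shift r, ℂ) => R hc) hS
        simpa [mul_apply_eq_comp, hker] using this.symm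
      have := congrArg (fun f : C(Shift r, ℂ) => f (fun _ => 0)) hzero
      exact (h.2 _).ne' (by simpa [hc] using this)
    have := le_iSup₂ (f := fun (k : ℂ) (_ : k ∈ spectrum ℂ T) => (‖k‖₊ : ENNReal)) (lam : ℂ) hmem
    refine le_trans (le_of_eq ?_) this
    rw [ENNReal.ofReal, ENNReal.coe_inj]
    ext
    simp [hlam.le, abs_of_pos hlam]

end SpectralRadius

/-! ### Normalized operator, eigenmeasure and variational principle -/

section Pressure

variable {r : ℕ}

/-- The operator `f ↦ L(h f) / (lam h)`, which is Markov if `h` is an eigenfunction of the transfer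
operator `L` of `ψ` for the eigenvalue `lam`. -/
def normalizedTransfer (ψ h : PosCont r) (lam : ℝ) : C(Shift r, ℝ) →ₗ[ℝ] C(Shift r, ℝ) where
  toFun f :=
    { toFun := fun x =>
        lam⁻¹ * (h.1 x)⁻¹ * ∑ j, ψ.1 (prepend j x) * h.1 (prepend j x) * f (prepend j x)
      continuous_toFun := by
        refine (continuous_const.mul (h.1.continuous.inv₀ fun x => (h.2 x).ne')).mul
          (continuous_finsetSum _ fun j _ => ?_)
        have := continuous_prepend j
        fun_prop }
  map_add' f g := by ext x; simp [Finset.sum_add_distrib, mul_add]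
  map_smul' c f := by ext x; simp [Finset.mul_sum, mul_left_comm]

theorem normalizedTransfer_apply (ψ h : PosCont r) (lam : ℝ) (f : C(Shift r, ℝ)) (x : Shift r) :
    normalizedTransfer ψ h lam f x =
      lam⁻¹ * (h.1 x)⁻¹ * ∑ j, ψ.1 (prepend j x) * h.1 (prepend j x) * f (prepend j x) := rfl

/-- All preimages `jx` have the same shift `x`, and by the eigenvalue equation the weights sum to
one. The case `f = 1` is the Markov property; the general case makes invariant measures
shift-invariant. -/
theorem normalizedTransfer_comp_leftShift (ψ h : PosCont r) {lam : ℝ} (hlam : 0 < lam)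
    (heig : ∀ x, ∑ j, ψ.1 (prepend j x) * h.1 (prepend j x) = lam * h.1 x) (f : C(Shift r, ℝ)) :
    normalizedTransfer ψ h lam (f.comp ⟨leftShift, continuous_leftShift⟩) = f := by
  ext x
  have := (h.2 x).ne'
  simp only [normalizedTransfer_apply, ContinuousMap.comp_apply, ContinuousMap.coe_mk,
    leftShift_prepend]
  rw [← Finset.sum_mul, heig]
  field_simp

theorem exists_invariant_normalizedTransfer [NeZero r] (ψ h : PosCont r) {lam : ℝ} (hlam : 0 < lam)
    (heig : ∀ x, ∑ j, ψ.1 (prepend j x) * h.1 (prepend j x) = lam * h.1 x) :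
    ∃ m : ProbabilityMeasure (Shift r), ∀ f : C(Shift r, ℝ),
      ∫ x, normalizedTransfer ψ h lam f x ∂(m : Measure (Shift r)) =
        ∫ x, f x ∂(m : Measure (Shift r)) :=
  exists_invariant_probabilityMeasure _
    (fun _ hf x => mul_nonneg (mul_nonneg (inv_nonneg.2 hlam.le) (inv_nonneg.2 (h.2 x).le))
      (Finset.sum_nonneg fun _ _ => mul_nonneg (mul_pos (ψ.2 _) (h.2 _)).le (hf _)))
    (normalizedTransfer_comp_leftShift ψ h hlam heig 1)

theorem integrable_continuousMap (m : ProbabilityMeasure (Shift r)) (f : C(Shift r, ℝ)) :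
    Integrable f (m : Measure (Shift r)) :=
  f.continuous.integrable_of_hasCompactSupport (HasCompactSupport.of_compactSpace f)

/-- The eigenmeasure `h⁻¹ m / ∫ h⁻¹ dm` and the eigenfunction normalized by it. -/
theorem exists_eigenmeasure (ψ h : PosCont r) {lam : ℝ} (hlam : 0 < lam)
    (heig : ∀ x, ∑ j, ψ.1 (prepend j x) * h.1 (prepend j x) = lam * h.1 x)
    (m : ProbabilityMeasure (Shift r))
    (hm : ∀ f : C(Shift r, ℝ), ∫ x, normalizedTransfer ψ h lam f x ∂(m : Measure (Shift r)) =
      ∫ x, f x ∂(m : Measure (Shift r))) :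
    ∃ (k : PosCont r) (ν : ProbabilityMeasure (Shift r)),
      (∀ x, ∑ j, ψ.1 (prepend j x) * k.1 (prepend j x) = lam * k.1 x) ∧
      (∀ f : C(Shift r, ℝ),
        ∫ x, ∑ j, ψ.1 (prepend j x) * f (prepend j x) ∂(ν : Measure (Shift r)) =
          lam * ∫ x, f x ∂(ν : Measure (Shift r))) ∧
      ∫ x, k.1 x ∂(ν : Measure (Shift r)) = 1 := by
  let hinv : C(Shift r, ℝ) := ⟨fun x => (h.1 x)⁻¹, h.1.continuous.inv₀ fun x => (h.2 x).ne'⟩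
  let Φ : C(Shift r, ℝ) →ₗ[ℝ] ℝ :=
    { toFun := fun f => ∫ x, (f * hinv) x ∂(m : Measure (Shift r))
      map_add' f g := by
        rw [← integral_add (integrable_continuousMap m _) (integrable_continuousMap m _)]
        simp [add_mul]
      map_smul' c f := by
        rw [RingHom.id_apply, smul_eq_mul, ← integral_const_mul]
        simp }
  have hΦ (f : C(Shift r, ℝ)) : Φ f = ∫ x, f x * (h.1 x)⁻¹ ∂(m : Measure (Shift r)) := rfl
  have hc : 0 < Φ 1 := by
    refine (integral_pos_iff_support_of_nonneg (fun x => ?_)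
      (integrable_continuousMap m (1 * hinv))).2 ?_
    · simpa [hinv] using (h.2 x).le
    · have : Function.support (1 * hinv : C(Shift r, ℝ)) = Set.univ :=
        Set.eq_univ_of_forall fun x => by simpa [hinv] using (h.2 x).ne'
      rw [this]
      simp
  obtain ⟨ν, hν⟩ := exists_probabilityMeasure_integral_eq ((Φ 1)⁻¹ • Φ)
    (fun f hf => mul_nonneg (inv_nonneg.2 hc.le) (integral_nonneg fun x =>
      mul_nonneg (hf x) (inv_nonneg.2 (h.2 x).le)))
    (inv_mul_cancel₀ hc.ne')
  have hν' (f : C(Shift r, ℝ)) : ∫ x, f x ∂(ν : Measure (Shift r)) = (Φ 1)⁻¹ * Φ f := hν f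
  -- The factor `Φ 1` cancels the normalization of `ν`, because `Φ h = 1`.
  refine ⟨⟨Φ 1 • h.1, fun x => mul_pos hc (h.2 x)⟩, ν, fun x => ?_, fun f => ?_, ?_⟩
  · simp only [ContinuousMap.smul_apply, smul_eq_mul, mul_left_comm _ (Φ 1)]
    rw [← Finset.mul_sum, heig]
  · let Lf : C(Shift r, ℝ) :=
      ⟨fun x => ∑ j, ψ.1 (prepend j x) * f (prepend j x), continuous_finsetSum _ fun j _ => by
        have := continuous_prepend j
        fun_prop⟩
    -- `L f / h = lam * P(f / h)` for the normalized operator `P`, so invariance of `m` at `f / h`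
    -- is the eigenmeasure equation.
    have hL : Φ Lf = lam * Φ f := by
      rw [hΦ f]
      refine Eq.trans ?_ (congrArg (lam * ·) (hm (f * hinv)))
      rw [hΦ Lf, ← integral_const_mul]
      refine integral_congr_ae (Eventually.of_forall fun x => ?_)
      have hx := (h.2 x).ne'
      have : ∑ j, ψ.1 (prepend j x) * h.1 (prepend j x) * (f * hinv) (prepend j x) =
          ∑ j, ψ.1 (prepend j x) * f (prepend j x) := by
        refine Finset.sum_congr rfl fun j _ => ?_
        have hj := (h.2 (prepend j x)).ne'
        simp only [ContinuousMap.mul_apply, hinv, ContinuousMap.coe_mk]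
        field_simp
      simp only [normalizedTransfer_apply, this, Lf, ContinuousMap.coe_mk]
      field_simp
    have := hν' Lf
    rw [hL] at this
    rw [hν' f]
    exact this.trans (by ring)
  · refine (hν' (Φ 1 • h.1)).trans ?_
    have : Φ h.1 = 1 := by
      rw [hΦ]
      simp [mul_inv_cancel₀ (h.2 _).ne']
    rw [map_smul, this, smul_eq_mul, mul_one, inv_mul_cancel₀ hc.ne']

/-- Every shift-invariant probability is the first marginal of a holonomic one. -/
theorem exists_mem_holonomic_of_shift_invariant (m : ProbabilityMeasure (Shift r))
    (hm : ∀ f : C(Shift r, ℝ), ∫ x, f (leftShift x) ∂(m : Measure (Shift r)) =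
      ∫ x, f x ∂(m : Measure (Shift r))) :
    ∃ ν ∈ holonomic r, baseMeasure ν = (m : Measure (Shift r)) := by
  -- Holonomy reads only the letter `w 1`; a constant word puts the deleted letter there. Prepending
  -- it restores `y`, and the first marginal is the image of `m` under the shift, which is `m`.
  let lift : Shift r → Shift r × (ℕ → Fin r) := fun y => (leftShift y, fun _ => y 0)
  have hlift : Measurable lift :=
    (continuous_leftShift.prodMk (continuous_pi fun _ => continuous_apply 0)).measurable
  let ν := m.map hlift.aemeasurable
  have hν : (ν : Measure (Shift r × (ℕ → Fin r))) = (m : Measure (Shift r)).map lift := rfl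
  have hbase : baseMeasure ν = (m : Measure (Shift r)) := by
    rw [baseMeasure, hν, Measure.map_map measurable_fst hlift]
    have : IsProbabilityMeasure ((m : Measure (Shift r)).map (Prod.fst ∘ lift)) :=
      Measure.isProbabilityMeasure_map (measurable_fst.comp hlift).aemeasurable
    refine ext_of_forall_integral_eq_of_IsFiniteMeasure fun f => ?_
    rw [integral_map (measurable_fst.comp hlift).aemeasurable
      f.continuous.aestronglyMeasurable]
    exact hm f.toContinuousMap
  refine ⟨ν, fun g => ?_, hbase⟩
  have hcont : Continuous fun p : Shift r × (ℕ → Fin r) => prepend (p.2 1) p.1 := by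
    refine continuous_pi fun n => ?_
    cases n with
    | zero => exact (continuous_apply 1).comp continuous_snd
    | succ n => exact (continuous_apply n).comp continuous_fst
  have hmap := integral_map (μ := (m : Measure (Shift r))) hlift.aemeasurable
    (g.continuous.comp hcont).aestronglyMeasurable
  simp only [Function.comp_apply, lift, prepend_leftShift] at hmap
  rw [hbase]
  exact hmap

theorem log_le_integral_log_transfer_div (ψ h : PosCont r) [NeZero r] {lam : ℝ} (hlam : 0 < lam)
    (heig : ∀ x, ∑ j, ψ.1 (prepend j x) * h.1 (prepend j x) = lam * h.1 x)
    (m : ProbabilityMeasure (Shift r))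
    (hm : ∀ f : C(Shift r, ℝ), ∫ x, normalizedTransfer ψ h lam f x ∂(m : Measure (Shift r)) =
      ∫ x, f x ∂(m : Measure (Shift r))) (g : PosCont r) :
    Real.log lam ≤
      ∫ x, Real.log ((∑ j, ψ.1 (prepend j x) * g.1 (prepend j x)) / g.1 x)
        ∂(m : Measure (Shift r)) := by
  let F : C(Shift r, ℝ) := ⟨fun x => Real.log (g.1 x / h.1 x),
    (g.1.continuous.div h.1.continuous fun x => (h.2 x).ne').log fun x =>
      (div_pos (g.2 x) (h.2 x)).ne'⟩
  have hsum_pos (x : Shift r) : 0 < ∑ j, ψ.1 (prepend j x) * g.1 (prepend j x) :=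
    Finset.sum_pos (fun j _ => mul_pos (ψ.2 _) (g.2 _)) Finset.univ_nonempty
  let R : C(Shift r, ℝ) :=
    ⟨fun x => Real.log ((∑ j, ψ.1 (prepend j x) * g.1 (prepend j x)) / g.1 x),
      Continuous.log ((continuous_finsetSum _ fun j _ => by
        have := continuous_prepend j
        fun_prop).div g.1.continuous fun x => (g.2 x).ne') fun x =>
        (div_pos (hsum_pos x) (g.2 x)).ne'⟩
  -- Jensen for `log` with the weights of the normalized operator and the values `g / h`. The term
  -- `P F - F` has integral zero under `m`.
  have hpt (x : Shift r) :
      Real.log lam + (normalizedTransfer ψ h lam F x - F x) ≤ R x := by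
    have hx := h.2 x
    have hw : ∑ j, lam⁻¹ * (h.1 x)⁻¹ * (ψ.1 (prepend j x) * h.1 (prepend j x)) = 1 := by
      rw [← Finset.mul_sum, heig]
      field_simp
    have jensen := strictConcaveOn_log_Ioi.concaveOn.le_map_sum (t := Finset.univ)
      (w := fun j => lam⁻¹ * (h.1 x)⁻¹ * (ψ.1 (prepend j x) * h.1 (prepend j x)))
      (p := fun j => g.1 (prepend j x) / h.1 (prepend j x))
      (fun j _ => by have := ψ.2 (prepend j x); have := h.2 (prepend j x); positivity) hw
      (fun j _ => div_pos (g.2 _) (h.2 _))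
    have hleft : ∑ j, (lam⁻¹ * (h.1 x)⁻¹ * (ψ.1 (prepend j x) * h.1 (prepend j x))) •
        Real.log (g.1 (prepend j x) / h.1 (prepend j x)) = normalizedTransfer ψ h lam F x := by
      rw [normalizedTransfer_apply, Finset.mul_sum]
      exact Finset.sum_congr rfl fun j _ => by rw [smul_eq_mul, mul_assoc (lam⁻¹ * _)]; rfl
    have hright : ∑ j, (lam⁻¹ * (h.1 x)⁻¹ * (ψ.1 (prepend j x) * h.1 (prepend j x))) •
        (g.1 (prepend j x) / h.1 (prepend j x)) =
        lam⁻¹ * (h.1 x)⁻¹ * ∑ j, ψ.1 (prepend j x) * g.1 (prepend j x) := by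
      rw [Finset.mul_sum]
      refine Finset.sum_congr rfl fun j _ => ?_
      have := (h.2 (prepend j x)).ne'
      rw [smul_eq_mul]
      field_simp
    rw [hleft, hright, Real.log_mul (by positivity) (hsum_pos x).ne',
      Real.log_mul (by positivity) (by positivity), Real.log_inv, Real.log_inv] at jensen
    have hR : R x = Real.log (∑ j, ψ.1 (prepend j x) * g.1 (prepend j x)) - Real.log (g.1 x) :=
      Real.log_div (hsum_pos x).ne' (g.2 x).ne'
    have hF : F x = Real.log (g.1 x) - Real.log (h.1 x) := Real.log_div (g.2 x).ne' hx.ne'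
    rw [hR, hF]
    linarith
  have hPF := integrable_continuousMap m (normalizedTransfer ψ h lam F)
  have hF := integrable_continuousMap m F
  calc Real.log lam = ∫ x, (Real.log lam + (normalizedTransfer ψ h lam F x - F x))
        ∂(m : Measure (Shift r)) := by
        have hadd := integral_add (integrable_const (μ := (m : Measure (Shift r))) (Real.log lam))
          (hPF.sub hF)
        simp only [Pi.sub_apply] at hadd
        rw [hadd, integral_sub hPF hF, hm]
        simp
    _ ≤ ∫ x, R x ∂(m : Measure (Shift r)) :=
        integral_mono ((integrable_const _).add (hPF.sub hF)) (integrable_continuousMap m R) hpt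

theorem isProbabilityMeasure_baseMeasure (ν : ProbabilityMeasure (Shift r × (ℕ → Fin r))) :
    IsProbabilityMeasure (baseMeasure ν) :=
  Measure.isProbabilityMeasure_map measurable_fst.aemeasurable

theorem iInf_add_coe {ι : Sort*} (f : ι → EReal) (c : ℝ) : (⨅ i, f i) + c = ⨅ i, (f i + c) := by
  refine le_antisymm (le_iInf fun i => add_le_add_left (iInf_le f i) _) ?_
  rw [← EReal.sub_le_iff_le_add (.inl (EReal.coe_ne_bot c)) (.inl (EReal.coe_ne_top c))]
  refine le_iInf fun i => ?_
  rw [EReal.sub_le_iff_le_add (.inl (EReal.coe_ne_bot c)) (.inl (EReal.coe_ne_top c))]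
  exact iInf_le _ i

/-- `L g = B_1(ψ g)`, so `log (L g / g) = log (B_1(ψ g) / (ψ g)) + log ψ`, and `g ↦ ψ g` maps the
positive cone onto itself. -/
theorem infLogRatio_eq_entropy_add [NeZero r] (ψ : PosCont r)
    {T : (Shift r → ℝ) → Shift r → ℝ}
    (hT : ∀ g x, T g x = ∑ j, ψ.1 (prepend j x) * g (prepend j x))
    (ν : ProbabilityMeasure (Shift r × (ℕ → Fin r))) :
    infLogRatio T ν = entropy ν + ((∫ x, Real.log (ψ.1 x) ∂(baseMeasure ν) : ℝ) : EReal) := by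
  have hprob := isProbabilityMeasure_baseMeasure ν
  let m : ProbabilityMeasure (Shift r) := ⟨baseMeasure ν, hprob⟩
  let mulψ (g : PosCont r) : PosCont r := ⟨ψ.1 * g.1, fun x => mul_pos (ψ.2 x) (g.2 x)⟩
  have hsurj : Function.Surjective mulψ := fun G => by
    refine ⟨⟨⟨fun x => (ψ.1 x)⁻¹ * G.1 x, (ψ.1.continuous.inv₀ fun x => (ψ.2 x).ne').mul
      G.1.continuous⟩, fun x => mul_pos (inv_pos.2 (ψ.2 x)) (G.2 x)⟩, ?_⟩
    ext x
    exact mul_inv_cancel_left₀ (ψ.2 x).ne' _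
  rw [entropy, infLogRatio, infLogRatio, ← hsurj.iInf_comp fun G : PosCont r =>
    ((∫ x, Real.log (transfer (fun _ _ => 1) G.1 x / G.1 x) ∂(baseMeasure ν) : ℝ) : EReal),
    iInf_add_coe]
  refine iInf_congr fun g => ?_
  rw [← EReal.coe_add, EReal.coe_eq_coe_iff]
  have hsum_pos (x : Shift r) : 0 < ∑ j, ψ.1 (prepend j x) * g.1 (prepend j x) :=
    Finset.sum_pos (fun j _ => mul_pos (ψ.2 _) (g.2 _)) Finset.univ_nonempty
  let R : C(Shift r, ℝ) :=
    ⟨fun x => Real.log ((∑ j, ψ.1 (prepend j x) * g.1 (prepend j x)) / (mulψ g).1 x),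
      Continuous.log ((continuous_finsetSum _ fun j _ => by
        have := continuous_prepend j
        fun_prop).div (mulψ g).1.continuous fun x => ((mulψ g).2 x).ne') fun x =>
        (div_pos (hsum_pos x) ((mulψ g).2 x)).ne'⟩
  let S : C(Shift r, ℝ) :=
    ⟨fun x => Real.log (ψ.1 x), ψ.1.continuous.log fun x => (ψ.2 x).ne'⟩
  have htr (x : Shift r) : transfer (fun _ _ => 1) (mulψ g).1 x =
      ∑ j, ψ.1 (prepend j x) * g.1 (prepend j x) := by
    simp [transfer, mulψ]
  simp only [htr, hT]
  refine Eq.trans ?_ (integral_add (integrable_continuousMap m R) (integrable_continuousMap m S))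
  refine integral_congr_ae (Eventually.of_forall fun x => ?_)
  have hψ := (ψ.2 x).ne'
  have hg := (g.2 x).ne'
  have hR : R x = Real.log (∑ j, ψ.1 (prepend j x) * g.1 (prepend j x)) -
      (Real.log (ψ.1 x) + Real.log (g.1 x)) := by
    rw [← Real.log_mul hψ hg]
    exact Real.log_div (hsum_pos x).ne' ((mulψ g).2 x).ne'
  have hS : S x = Real.log (ψ.1 x) := rfl
  refine Eq.trans ?_ (congrArg₂ (· + ·) hR hS).symm
  exact (Real.log_div (hsum_pos x).ne' hg).trans (by ring)

end Pressure
end GrandCanonical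

end

/-! ### Assembly of the theorem -/

theorem mainTheorem2 (r : ℕ) (hr : 2 ≤ r) (β μ : ℝ) (hβ : 0 < β) (hμ : μ < 0)
    (A : ℕ → GrandCanonical.Shift r → ℝ)
    (M : ℝ) (hM : 0 < M) (hLip : GrandCanonical.UniformlyLipschitz A M)
    (hSuper : GrandCanonical.Superlinear A μ)
    (hAdm : GrandCanonical.Admissible β μ A) :
    (∀ (g : C(GrandCanonical.Shift r, ℝ)) (x : GrandCanonical.Shift r),
      GrandCanonical.ruelle β μ A g x =
        GrandCanonical.transfer (GrandCanonical.weight β μ A) g x) ∧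
    GrandCanonical.pressure β μ A =
      GrandCanonical.potentialPressure (GrandCanonical.potential β μ A) ∧
    (GrandCanonical.equilibriumStates (GrandCanonical.potential β μ A)).Nonempty ∧
    ∃ lam : ℝ, GrandCanonical.IsGrandCanonicalEigenvalue β μ A lam ∧
      GrandCanonical.pressure β μ A = ((Real.log lam : ℝ) : EReal) := by
  open GrandCanonical in
  have : NeZero r := ⟨by omega⟩
  have hexp := potential_le_exp_mul hβ hLip hAdm
  let ψ : PosCont r := ⟨⟨potential β μ A, continuous_of_le_exp_mul (potential_pos hAdm) hexp⟩,
    potential_pos hAdm⟩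
  have hruelle (g : Shift r → ℝ) (x : Shift r) :
      ruelle β μ A g x = ∑ j, ψ.1 (prepend j x) * g (prepend j x) := ruelle_eq_sum hAdm g x
  have hratio (ν : ProbabilityMeasure (Shift r × (ℕ → Fin r))) : infLogRatio (ruelle β μ A) ν =
      entropy ν + ((∫ x, Real.log (potential β μ A x) ∂(baseMeasure ν) : ℝ) : EReal) :=
    infLogRatio_eq_entropy_add ψ hruelle ν
  obtain ⟨lam, hlam, h, heig⟩ := exists_eigenfunction ψ hexp (by positivity)
  obtain ⟨m, hm⟩ := exists_invariant_normalizedTransfer ψ h hlam heig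
  obtain ⟨k, η, hk, hη, hkη⟩ := exists_eigenmeasure ψ h hlam heig m hm
  obtain ⟨ν, hν, hbase⟩ := exists_mem_holonomic_of_shift_invariant m fun f => by
    have := hm (f.comp ⟨leftShift, continuous_leftShift⟩)
    rw [normalizedTransfer_comp_leftShift ψ h hlam heig] at this
    exact this.symm
  have hupper (ν : ProbabilityMeasure (Shift r × (ℕ → Fin r))) :
      infLogRatio (ruelle β μ A) ν ≤ ((Real.log lam : ℝ) : EReal) := by
    have := isProbabilityMeasure_baseMeasure ν
    -- At the test function `h` the integrand is the constant `log lam`, so holonomy is not needed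
    -- for this bound.
    refine (iInf_le _ h).trans (le_of_eq ?_)
    have (x : Shift r) : ruelle β μ A h.1 x / h.1 x = lam := by
      rw [hruelle, heig, mul_div_cancel_right₀ _ (h.2 x).ne']
    simp [this]
  have hlower : ((Real.log lam : ℝ) : EReal) ≤ infLogRatio (ruelle β μ A) ν := by
    refine le_iInf fun g => EReal.coe_le_coe_iff.2 ?_
    simp only [hbase, hruelle]
    exact log_le_integral_log_transfer_div ψ h hlam heig m hm g
  have hpressure : pressure β μ A = ((Real.log lam : ℝ) : EReal) :=
    le_antisymm (iSup₂_le fun ν _ => hupper ν)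
      (hlower.trans (le_iSup₂ (f := fun ν (_ : ν ∈ holonomic r) =>
        infLogRatio (ruelle β μ A) ν) ν hν))
  have hpot : pressure β μ A = potentialPressure (potential β μ A) := by
    simp only [pressure, potentialPressure, hratio]
  refine ⟨fun g x => ruelle_eq_sum hAdm g x, hpot, ⟨ν, hν, ?_⟩, lam,
    ⟨hlam, isSpectralRadius_of_eigenfunction hAdm ψ h (fun _ => rfl) hlam heig, k, η,
      fun x => ?_, fun f => ?_, hkη⟩, hpressure⟩
  · rw [← hpot, ← hratio, hpressure]
    exact le_antisymm hlower (hupper ν)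
  · rw [hruelle, hk]
  · simp only [hruelle, hη]
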